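/- Let $d\in\{2,3\}$, let $\Omega\subset\mathbb R^d$ be a bounded open connected polygonal (polyhedral) domain, and let $\Gamma=\bigcup_{j=1}^J\Gamma_j\Subset\Omega$ be a polygonal (polyhedral) interface that separates $\Omega$ into two disjoint nonempty open sets $\Omega_0,\Omega_1$ (so $\Omega\setminus\Gamma=\Omega_0\cup\Omega_1$, $\overline{\Omega}_0\cup\overline{\Omega}_1=\overline{\Omega}$ and $\Omega\cap\partial\Omega_0=\Omega\cap\partial\Omega_1=\Gamma$), where the sides $\Gamma_j$ are nondegenerate line segments if $d=2$ and planar polygons if $d=3$ (connected finite unions of nondegenerate coplanar triangles), any two of which overlap in a set of $(d-1)$-dimensional measure zero only. Let $C_\nu$ be a real constant and $m\ge 0$ an integer. For a partition $\mathcal T_h$ of $\Omega$ into finitely many nondegenerate triangles (tetrahedra) with pairwise disjoint interiors, let $h_K$ be the diameter of $K\in\mathcal T_h$, $\rho_K$ the radius of the largest ball inscribed in $K$, $\boldsymbol x_K$ the barycenter of $K$, $h=\max_K h_K$, $\rho=\min_K\rho_K$, and $B_{\tau(K)}=B(\boldsymbol x_K,h_K)$ the ball of center $\boldsymbol x_K$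 and radius $h_K$. For an element $K$ put $$\Gamma_K=\Gamma\cap K,\qquad \Gamma_{B_{\tau(K)}}=\bigcup_{j:\ \Gamma_j\cap K\neq\varnothing}\bigl(\Gamma_j\cap B_{\tau(K)}\bigr)\subset\Gamma\cap B_{\tau(K)} .$$ Then there are constants $h_1>0$ and $C>0$, depending only on $d$, $\Omega$, $\Gamma$ (with its sides), $C_\nu$ and $m$, such that for every such partition $\mathcal T_h$ with $h\le C_\nu\rho$ and $h<h_1$, every element $K\in\mathcal T_h$ with $K\cap\Gamma\neq\varnothing$, and every polynomial $w$ on $\mathbb R^d$ of total degree at most $m$, $$\|w\|_{L^\infty(\Gamma_K)}\le C\,h_K^{(1-d)/2}\,\|w\|_{L^2(\Gamma_{B_{\tau(K)}})},$$ where the norms are taken with respect to the $(d-1)$-dimensional surface measure. This holds both when the elements are understood as open simplices and when they are understood as closed simplices. -/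

import Mathlib

open MeasureTheory
open scoped ENNReal

noncomputable section

namespace UnfittedFEM

/-- Euclidean `d`-space. -/
abbrev E (d : ℕ) : Type := EuclideanSpace ℝ (Fin d)

/-- A flat `(d-1)`-dimensional side in `ℝ^d`: a connected subset of a hyperplane which is a finite
union of nondegenerate `(d-1)`-simplices (each given by `d` affinely independent vertices).
For `d = 2` these are exactly the nondegenerate line segments, for `d = 3` they are the planar
polygons, not necessarily convex and possibly with holes. -/
def IsSide {d : ℕ} (P : Set (E d)) : Prop :=
  IsConnected P ∧
  (∃ H : AffineSubspace ℝ (E d), Module.finrank ℝ H.direction + 1 = d ∧ P ⊆ (H : Set (E d))) ∧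
  ∃ S : Set (Fin d → E d), S.Finite ∧ (∀ v ∈ S, AffineIndependent ℝ v) ∧
    P = ⋃ v ∈ S, convexHull ℝ (Set.range v)

/-- A bounded polygonal (polyhedral) domain: open, connected, bounded, and with a boundary that is
a finite union of segments (polygons). -/
structure IsPolyhedralDomain {d : ℕ} (Ω : Set (E d)) : Prop where
  isOpen : IsOpen Ω
  isConnected : IsConnected Ω
  isBounded : Bornology.IsBounded Ω
  frontier_eq : ∃ F : Set (Set (E d)), F.Finite ∧ (∀ P ∈ F, IsSide P) ∧ frontier Ω = ⋃₀ F

/-- A polygonal (polyhedral) interface `Γ`, compactly contained in `Ω`, with its sides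
`Γ_1, …, Γ_J`, that separates `Ω` into the disjoint open sets `Ω₀` and `Ω₁`. -/
structure PolyhedralInterface {d : ℕ} (Ω : Set (E d)) where
  /-- the number of sides -/
  J : ℕ
  /-- the sides -/
  side : Fin J → Set (E d)
  isSide : ∀ j, IsSide (side j)
  /-- different sides overlap in a set of surface measure zero only -/
  side_inter : ∀ i j, i ≠ j → (μHE[d - 1] : Measure (E d)) (side i ∩ side j) = 0
  /-- as a finite union of compact sides, the interface is then compactly contained in `Ω` -/
  side_subset : ∀ j, side j ⊆ Ω
  Ω₀ : Set (E d)
  Ω₁ : Set (E d)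
  isOpen₀ : IsOpen Ω₀
  isOpen₁ : IsOpen Ω₁
  nonempty₀ : Ω₀.Nonempty
  nonempty₁ : Ω₁.Nonempty
  disjoint : Disjoint Ω₀ Ω₁
  closure_union : closure Ω₀ ∪ closure Ω₁ = closure Ω
  diff_eq : Ω \ (⋃ j, side j) = Ω₀ ∪ Ω₁
  frontier₀ : Ω ∩ frontier Ω₀ = ⋃ j, side j
  frontier₁ : Ω ∩ frontier Ω₁ = ⋃ j, side j

/-- The interface as a set, `Γ = ⋃ j, Γ_j`. -/
def PolyhedralInterface.Γ {d : ℕ} {Ω : Set (E d)} (I : PolyhedralInterface Ω) : Set (E d) :=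
  ⋃ j, I.side j

/-- The diameter `h_K` of a simplex. -/
def diamK {d : ℕ} (T : Affine.Simplex ℝ (E d) d) : ℝ := Metric.diam T.closedInterior

/-- The radius `ρ_K` of the largest ball inscribed in a simplex. -/
def inradiusK {d : ℕ} (T : Affine.Simplex ℝ (E d) d) : ℝ :=
  sSup {r : ℝ | ∃ c : E d, Metric.closedBall c r ⊆ T.closedInterior}

/-- A partition of `Ω` into finitely many nondegenerate simplices with pairwise disjoint
interiors. -/
structure Mesh {d : ℕ} (Ω : Set (E d)) where
  elems : Finset (Affine.Simplex ℝ (E d) d)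
  disjoint : ∀ T ∈ elems, ∀ T' ∈ elems, T ≠ T' → Disjoint T.interior T'.interior
  cover : ⋃ T ∈ elems, T.closedInterior = closure Ω

/-- The mesh size `h = max_K h_K`. -/
def Mesh.h {d : ℕ} {Ω : Set (E d)} (M : Mesh Ω) : ℝ := ⨆ T : M.elems, diamK T.1

/-- `ρ = min_K ρ_K`. -/
def Mesh.ρ {d : ℕ} {Ω : Set (E d)} (M : Mesh Ω) : ℝ := ⨅ T : M.elems, inradiusK T.1

/-- Quasi-uniformity with constant `Cν`: `h ≤ Cν ρ`. -/
def Mesh.IsQuasiUniform {d : ℕ} {Ω : Set (E d)} (M : Mesh Ω) (Cν : ℝ) : Prop := M.h ≤ Cν * M.ρ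

/-- The ball `B_τ(K) = B(x_K, h_K)` around the barycenter `x_K`. -/
def ballτ {d : ℕ} (T : Affine.Simplex ℝ (E d) d) : Set (E d) :=
  Metric.ball T.centroid (diamK T)

/-- `Γ_{B_τ(K)}`: the part in `B_τ(K)` of those sides of `Γ` that intersect the element. The
element is the set `K`, the open or the closed simplex `T`. -/
def PolyhedralInterface.Γτ {d : ℕ} {Ω : Set (E d)} (I : PolyhedralInterface Ω)
    (T : Affine.Simplex ℝ (E d) d) (K : Set (E d)) : Set (E d) :=
  ⋃ j ∈ {j | (I.side j ∩ K).Nonempty}, I.side j ∩ ballτ T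

/-- The norm of `w` in `L^p(S)` with respect to the `(d-1)`-dimensional surface measure. -/
def surfaceNorm {d : ℕ} (w : E d → ℝ) (p : ℝ≥0∞) (S : Set (E d)) : ℝ≥0∞ :=
  eLpNorm w p ((μHE[d - 1] : Measure (E d)).restrict S)

/-- The polynomial function on `ℝ^d` given by `p`. -/
def polyFun {d : ℕ} (p : MvPolynomial (Fin d) ℝ) : E d → ℝ :=
  fun x => MvPolynomial.eval (fun i => x i) p

end UnfittedFEM

end

open UnfittedFEM

namespace UnfittedFEM

/-! Fix x in Γ ∩ K and a simplex σ containing x in the triangulation of a side. The homothety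
centred at x with ratio t = h_K / L shrinks σ to a copy that stays in σ by convexity, since h_K < L.
The copy also lies in the ball B_τ(K), because x is at distance at most d/(d+1) · h_K from the
barycenter (`dist_centroid_le`). Pulling w back along this homothety keeps its degree and its value
at x. So the norm equivalence on the fixed set σ (`exists_enorm_polyFun_le`) applies, and the change
of variables (`eLpNorm_comp_homothety`) contributes t^(-(d-1)/2), the required power of h_K. The
sides consist of finitely many simplices, so one constant serves all x and K. -/

/-! ### Polynomials of bounded degree on a compact set -/

theorem continuous_polyFun {d : ℕ} (p : MvPolynomial (Fin d) ℝ) : Continuous (polyFun p) :=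
  (MvPolynomial.continuous_eval p).comp (by fun_prop)

/-- Substituting polynomials of degree at most one does not increase the total degree. -/
theorem totalDegree_bind₁_le {σ τ : Type*} {R : Type*} [CommSemiring R]
    (f : σ → MvPolynomial τ R) (hf : ∀ i, (f i).totalDegree ≤ 1) (p : MvPolynomial σ R) :
    (MvPolynomial.bind₁ f p).totalDegree ≤ p.totalDegree := by
  rw [← MvPolynomial.aeval_eq_bind₁, MvPolynomial.aeval_def, MvPolynomial.eval₂_eq]
  refine MvPolynomial.totalDegree_finsetSum_le fun s hs => ?_
  refine (MvPolynomial.totalDegree_mul _ _).trans ?_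
  rw [MvPolynomial.algebraMap_eq, MvPolynomial.totalDegree_C, zero_add]
  refine (MvPolynomial.totalDegree_finsetProd _ _).trans ?_
  refine le_trans (Finset.sum_le_sum fun i _ => ?_) (MvPolynomial.le_totalDegree hs)
  exact (MvPolynomial.totalDegree_pow _ _).trans (by simpa using Nat.mul_le_mul_left (s i) (hf i))

/-- The polynomials of degree at most `m` are stable under homotheties. -/
theorem exists_polyFun_comp_homothety {d : ℕ} (x : E d) (t : ℝ) (p : MvPolynomial (Fin d) ℝ) :
    ∃ q : MvPolynomial (Fin d) ℝ, q.totalDegree ≤ p.totalDegree ∧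
      polyFun q = polyFun p ∘ AffineMap.homothety x t := by
  refine ⟨MvPolynomial.bind₁ (fun i => MvPolynomial.C t * MvPolynomial.X i +
    MvPolynomial.C (x i - t * x i)) p, totalDegree_bind₁_le _ (fun i => ?_) p, ?_⟩
  · refine (MvPolynomial.totalDegree_add _ _).trans (max_le ?_ ?_)
    · exact (MvPolynomial.totalDegree_mul _ _).trans (by simp)
    · rw [MvPolynomial.totalDegree_C]
      exact zero_le_one
  · funext y
    simp only [polyFun, Function.comp_apply]
    have h := MvPolynomial.eval₂Hom_bind₁ (RingHom.id ℝ) (fun i => y i)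
      (fun i => MvPolynomial.C t * MvPolynomial.X i + MvPolynomial.C (x i - t * x i)) p
    refine h.trans ?_
    change MvPolynomial.eval _ p = _
    congr 2
    funext i
    simp [AffineMap.homothety_apply]
    ring

/-- On a compact set all of whose relatively open parts have positive measure, the supremum of a
polynomial of bounded degree is controlled by its `L²` norm. -/
theorem exists_enorm_polyFun_le {d : ℕ} (m : ℕ) {σ : Set (E d)} (hσ : IsCompact σ)
    (μ : Measure (E d)) (hfin : μ σ ≠ ∞)
    (hpos : ∀ x ∈ σ, ∀ U : Set (E d), IsOpen U → x ∈ U → μ (U ∩ σ) ≠ 0) :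
    ∃ C : NNReal, ∀ p : MvPolynomial (Fin d) ℝ, p.totalDegree ≤ m → ∀ x ∈ σ,
      ‖polyFun p x‖ₑ ≤ C * eLpNorm (polyFun p) 2 (μ.restrict σ) := by
  have hms : MeasurableSet σ := hσ.measurableSet
  have hemb := MeasurableEmbedding.subtype_coe hms
  let ν : Measure σ := Measure.comap Subtype.val μ
  have hν : ν.map Subtype.val = μ.restrict σ := by
    rw [hemb.map_comap, Subtype.range_coe]
  have : CompactSpace σ := isCompact_iff_compactSpace.mp hσ
  have : IsFiniteMeasure ν := ⟨by
    rw [comap_subtype_coe_apply hms]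
    simpa using hfin.lt_top⟩
  have : ν.IsOpenPosMeasure := ⟨by
    rintro U hU ⟨x, hx⟩
    obtain ⟨V, hV, rfl⟩ := isOpen_induced_iff.mp hU
    rw [comap_subtype_coe_apply hms, Subtype.image_preimage_coe, Set.inter_comm]
    exact hpos x x.2 V hV hx⟩
  let R : MvPolynomial.restrictTotalDegree (Fin d) ℝ m →ₗ[ℝ] C(σ, ℝ) :=
    { toFun := fun p => ⟨fun x => polyFun p.1 x, (continuous_polyFun p.1).comp (by fun_prop)⟩
      map_add' := fun p q => by ext; simp [polyFun]
      map_smul' := fun c p => by ext; simp [polyFun] }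
  -- The domain is the space of restrictions to `σ`: a nonzero polynomial may vanish on a flat `σ`,
  -- so injectivity would fail on polynomials themselves.
  let N : LinearMap.range R →ₗ[ℝ] Lp ℝ 2 ν :=
    (ContinuousMap.toLp (E := ℝ) 2 ν ℝ).toLinearMap ∘ₗ (LinearMap.range R).subtype
  have hN : LinearMap.ker N = ⊥ := LinearMap.ker_eq_bot.mpr
    ((ContinuousMap.toLp_injective (𝕜 := ℝ) ν).comp Subtype.val_injective)
  obtain ⟨C, -, hC⟩ := LinearMap.exists_antilipschitzWith (𝕜 := ℝ) (E := LinearMap.range R)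
    (F := Lp ℝ 2 ν) N hN
  refine ⟨C, fun p hp x hx => ?_⟩
  let q : MvPolynomial.restrictTotalDegree (Fin d) ℝ m :=
    ⟨p, (MvPolynomial.mem_restrictTotalDegree _ _ _).mpr hp⟩
  have h1 : ‖R q‖ ≤ C * ‖ContinuousMap.toLp (E := ℝ) 2 ν ℝ (R q)‖ := by
    simpa [N] using hC.le_mul_dist ⟨R q, q, rfl⟩ 0
  have h2 : ‖ContinuousMap.toLp (E := ℝ) 2 ν ℝ (R q)‖ₑ =
      eLpNorm (polyFun p) 2 (μ.restrict σ) := by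
    rw [Lp.enorm_def, eLpNorm_congr_ae (ContinuousMap.coeFn_toLp ν (R q)), ← hν,
      hemb.eLpNorm_map_measure]
    rfl
  rw [← h2]
  have h3 : ‖polyFun p x‖ ≤ ‖R q‖ := (R q).norm_coe_le_norm ⟨x, hx⟩
  have h4 := ENNReal.ofReal_le_ofReal (h3.trans h1)
  rwa [ENNReal.ofReal_mul C.coe_nonneg, ofReal_norm, ofReal_norm, ENNReal.ofReal_coe_nnreal] at h4

/-! ### Surface measure, simplices and homotheties -/

/-- A nondegenerate `n`-simplex has positive and finite `n`-dimensional measure. -/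
theorem euclideanHausdorffMeasure_convexHull_pos_lt_top {V : Type*} [NormedAddCommGroup V]
    [InnerProductSpace ℝ V] [MeasurableSpace V] [BorelSpace V] {n : ℕ} {v : Fin (n + 1) → V}
    (hv : AffineIndependent ℝ v) :
    0 < (μHE[n] : Measure V) (convexHull ℝ (Set.range v)) ∧
      (μHE[n] : Measure V) (convexHull ℝ (Set.range v)) < ∞ := by
  let D := vectorSpan ℝ (Set.range v)
  have hD : Module.finrank ℝ D = n := hv.finrank_vectorSpan (by simp)
  have : FiniteDimensional ℝ D :=
    finiteDimensional_vectorSpan_of_finite ℝ (Set.finite_range v)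
  -- An isometric chart of the affine span: `D` has dimension `n`, so `μHE[n]` is a Haar measure
  -- there.
  let φ : D →ᵃ[ℝ] V := D.subtype.toAffineMap + AffineMap.const ℝ D (v 0)
  let u : Fin (n + 1) → D := fun i => ⟨v i - v 0,
    vsub_mem_vectorSpan ℝ (Set.mem_range_self i) (Set.mem_range_self 0)⟩
  have hφu : φ ∘ u = v := by
    funext i
    simp [φ, u]
  have hφ : Isometry φ := Isometry.of_dist_eq fun a b => by
    simp [φ, Subtype.dist_eq]
  have himg : φ '' convexHull ℝ (Set.range u) = convexHull ℝ (Set.range v) := by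
    rw [AffineMap.image_convexHull, ← Set.range_comp, hφu]
  have hu : AffineIndependent ℝ u := AffineIndependent.of_comp φ (by rwa [hφu])
  have hint : (interior (convexHull ℝ (Set.range u))).Nonempty := by
    rw [interior_convexHull_nonempty_iff_affineSpan_eq_top,
      hu.affineSpan_eq_top_iff_card_eq_finrank_add_one, hD, Fintype.card_fin]
  have hhaar : (μHE[n] : Measure D).IsAddHaarMeasure := by
    have h : (μHE[Module.finrank ℝ D] : Measure D).IsAddHaarMeasure := inferInstance
    rwa [hD] at h
  rw [← himg, hφ.euclideanHausdorffMeasure_image]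
  exact ⟨Measure.measure_pos_of_nonempty_interior _ hint,
    ((Set.finite_range u).isCompact_convexHull (𝕜 := ℝ)).measure_lt_top⟩

theorem homothety_image_subset {V : Type*} [NormedAddCommGroup V] [NormedSpace ℝ V] {σ : Set V}
    (hσ : Convex ℝ σ) {x : V} (hx : x ∈ σ) {t : ℝ} (ht : t ∈ Set.Icc (0 : ℝ) 1) :
    AffineMap.homothety x t '' σ ⊆ σ := by
  rintro _ ⟨y, hy, rfl⟩
  rw [AffineMap.homothety_eq_lineMap]
  exact hσ.lineMap_mem hx hy ht

/-- A convex set of positive measure has positive measure near each of its points. -/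
theorem measure_inter_ne_zero_of_convex {V : Type*} [NormedAddCommGroup V] [NormedSpace ℝ V]
    [MeasurableSpace V] [BorelSpace V] {n : ℕ} {σ : Set V} (hσ : Convex ℝ σ)
    (hb : Bornology.IsBounded σ) (hpos : (μHE[n] : Measure V) σ ≠ 0) {x : V} (hx : x ∈ σ)
    {U : Set V} (hU : IsOpen U) (hxU : x ∈ U) : (μHE[n] : Measure V) (U ∩ σ) ≠ 0 := by
  obtain ⟨ε, hε, hεU⟩ := Metric.isOpen_iff.mp hU x hxU
  obtain ⟨r, hr, hrσ⟩ := hb.subset_closedBall_lt 0 x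
  have ht0 : 0 < min 1 (ε / (2 * r)) := by positivity
  have hsub : AffineMap.homothety x (min 1 (ε / (2 * r))) '' σ ⊆ U ∩ σ := by
    refine Set.subset_inter ?_ (homothety_image_subset hσ hx ⟨ht0.le, min_le_left _ _⟩)
    rintro _ ⟨y, hy, rfl⟩
    apply hεU
    rw [Metric.mem_ball, dist_homothety_center, Real.norm_of_nonneg ht0.le]
    have hy' : dist x y ≤ r := by
      rw [dist_comm]
      exact hrσ hy
    calc min 1 (ε / (2 * r)) * dist x y ≤ ε / (2 * r) * r := by
          gcongr
          exact min_le_right _ _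
      _ = ε / 2 := by field_simp
      _ < ε := by linarith
  intro h0
  have h1 := measure_mono_null hsub h0
  rw [euclideanHausdorffMeasure_homothety_image n x ht0.ne'] at h1
  rcases smul_eq_zero.mp h1 with h | h
  · exact ht0.ne' (by simpa using eq_zero_of_pow_eq_zero h)
  · exact hpos h

/-- Behaviour of `L²` norms under homotheties. -/
theorem eLpNorm_comp_homothety {V : Type*} [NormedAddCommGroup V] [NormedSpace ℝ V]
    [MeasurableSpace V] [BorelSpace V] (n : ℕ) (x : V) {t : ℝ} (ht : 0 < t) {σ : Set V}
    (hσ : IsCompact σ) (w : V → ℝ) :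
    eLpNorm (w ∘ AffineMap.homothety x t) 2 ((μHE[n] : Measure V).restrict σ) =
      ENNReal.ofReal (t ^ (-(n : ℝ) / 2)) *
        eLpNorm w 2 ((μHE[n] : Measure V).restrict (AffineMap.homothety x t '' σ)) := by
  have hcont : Continuous (AffineMap.homothety x t) := AffineMap.homothety_continuous x t
  have hinj : Function.Injective (AffineMap.homothety x t) :=
    (AffineEquiv.homothetyUnitsMulHom x (Units.mk0 t ht.ne')).injective
  have hemb : MeasurableEmbedding (AffineMap.homothety x t) :=
    (Topology.IsOpenEmbedding.of_continuous_injective_isOpenMap hcont hinj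
      (AffineMap.homothety_isOpenMap x t ht.ne')).measurableEmbedding
  have hmap : (μHE[n] : Measure V).map (AffineMap.homothety x t) =
      ENNReal.ofReal (t⁻¹ ^ n) • (μHE[n] : Measure V) := by
    ext s hs
    rw [hemb.map_apply, euclideanHausdorffMeasure_homothety_preimage n x ht.ne',
      Measure.smul_apply, ENNReal.smul_def, ENNReal.ofReal_pow (by positivity)]
    congr 1
    rw [ENNReal.coe_pow, ← nnnorm_inv, ← enorm_eq_nnnorm, Real.enorm_of_nonneg (by positivity)]
  have hrestr : ((μHE[n] : Measure V).restrict σ).map (AffineMap.homothety x t) =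
      ENNReal.ofReal (t⁻¹ ^ n) •
        (μHE[n] : Measure V).restrict (AffineMap.homothety x t '' σ) := by
    rw [← Measure.restrict_smul, ← hmap, Measure.restrict_map hemb.measurable
      (hσ.image hcont).measurableSet, hinj.preimage_image]
  rw [← hemb.eLpNorm_map_measure, hrestr, eLpNorm_smul_measure_of_ne_top (by simp), smul_eq_mul,
    ENNReal.ofReal_rpow_of_nonneg (by positivity) (by positivity)]
  congr 2
  rw [← Real.rpow_natCast, ← Real.rpow_mul (by positivity), Real.inv_rpow ht.le,
    ← Real.rpow_neg ht.le]
  congr 1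
  simp
  ring

/-- The local inverse estimate on a simplex: the value of a polynomial at a point `x` is controlled
by its `L²` norm on the simplex shrunk towards `x`. -/
theorem exists_enorm_polyFun_le_homothety {d n : ℕ} (m : ℕ) {v : Fin (n + 1) → E d}
    (hv : AffineIndependent ℝ v) :
    ∃ C : NNReal, ∀ p : MvPolynomial (Fin d) ℝ, p.totalDegree ≤ m →
      ∀ x ∈ convexHull ℝ (Set.range v), ∀ t : ℝ, 0 < t →
        ‖polyFun p x‖ₑ ≤ C * (ENNReal.ofReal (t ^ (-(n : ℝ) / 2)) *
          eLpNorm (polyFun p) 2 ((μHE[n] : Measure (E d)).restrict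
            (AffineMap.homothety x t '' convexHull ℝ (Set.range v)))) := by
  have hc : IsCompact (convexHull ℝ (Set.range v)) :=
    (Set.finite_range v).isCompact_convexHull (𝕜 := ℝ)
  obtain ⟨hpos, hfin⟩ := euclideanHausdorffMeasure_convexHull_pos_lt_top hv
  obtain ⟨C, hC⟩ := exists_enorm_polyFun_le m hc μHE[n] hfin.ne fun x hx U hU hxU =>
    measure_inter_ne_zero_of_convex (convex_convexHull ℝ _) hc.isBounded hpos.ne' hx hU hxU
  refine ⟨C, fun p hp x hx t ht => ?_⟩
  obtain ⟨q, hq, hqp⟩ := exists_polyFun_comp_homothety x t p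
  have h := hC q (hq.trans hp) x hx
  rwa [hqp, eLpNorm_comp_homothety n x ht hc, Function.comp_apply,
    AffineMap.homothety_apply_same] at h

/-! ### Mesh geometry -/

theorem diamK_pos {n : ℕ} (T : Affine.Simplex ℝ (E (n + 1)) (n + 1)) : 0 < diamK T := by
  have h : T.points 0 ≠ T.points 1 := T.independent.injective.ne (by simp)
  exact (dist_pos.mpr h).trans_le (Metric.dist_le_diam_of_mem T.isCompact_closedInterior.isBounded
    (T.point_mem_closedInterior 0) (T.point_mem_closedInterior 1))

/-- The points of a simplex are well inside the ball around its barycenter. -/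
theorem dist_centroid_le {d : ℕ} (T : Affine.Simplex ℝ (E d) d) {x : E d}
    (hx : x ∈ T.closedInterior) : dist x T.centroid ≤ d / (d + 1) * diamK T := by
  have hsub : T.closedInterior ⊆ Metric.closedBall T.centroid (d / (d + 1) * diamK T) := by
    rw [← T.convexHull_eq_closedInterior]
    refine convexHull_min ?_ (convex_closedBall _ _)
    rintro _ ⟨i, rfl⟩
    have h := T.smul_centroid_vsub_point_eq_sum_vsub i
    have hle : ‖∑ j, (T.points j -ᵥ T.points i)‖ ≤ d * diamK T := by
      -- The term `j = i` vanishes; only `d` of the `d + 1` terms remain, hence the factor `d / (d +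
      -- 1)`.
      rw [← Finset.sum_erase (Finset.univ) (a := i) (by simp)]
      refine (norm_sum_le_of_le _ (f := fun j => T.points j -ᵥ T.points i) (n := fun _ => diamK T)
        fun j _ => ?_).trans (by simp)
      rw [← dist_eq_norm_vsub]
      exact Metric.dist_le_diam_of_mem T.isCompact_closedInterior.isBounded
        (T.point_mem_closedInterior j) (T.point_mem_closedInterior i)
    rw [← h, norm_smul, ← dist_eq_norm_vsub, Real.norm_of_nonneg (by positivity)] at hle
    rw [Metric.mem_closedBall, dist_comm, div_mul_eq_mul_div, le_div_iff₀ (by positivity)]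
    linarith
  exact hsub hx

theorem diamK_le_h {d : ℕ} {Ω : Set (E d)} (M : Mesh Ω) {T : Affine.Simplex ℝ (E d) d}
    (hT : T ∈ M.elems) : diamK T ≤ M.h :=
  le_ciSup (f := fun T : M.elems => diamK T.1) (Set.finite_range _).bddAbove ⟨T, hT⟩

/-! ### Uniformity over the interface and conclusion -/

/-- All simplices of all sides of an interface share one constant in the local inverse estimate
and one bound for the diameters. -/
theorem exists_uniform_local_estimate {n : ℕ} (m : ℕ) {Ω : Set (E (n + 1))}
    (I : PolyhedralInterface Ω) :
    ∃ C D : ℝ, 0 < C ∧ 0 < D ∧ ∀ j, ∀ x ∈ I.side j, ∃ σ : Set (E (n + 1)),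
      x ∈ σ ∧ σ ⊆ I.side j ∧ Convex ℝ σ ∧ (∀ y ∈ σ, dist x y ≤ D) ∧
      ∀ p : MvPolynomial (Fin (n + 1)) ℝ, p.totalDegree ≤ m → ∀ t : ℝ, 0 < t →
        ‖polyFun p x‖ₑ ≤ ENNReal.ofReal (C * t ^ (-(n : ℝ) / 2)) *
          eLpNorm (polyFun p) 2 ((μHE[n] : Measure (E (n + 1))).restrict
            (AffineMap.homothety x t '' σ)) := by
  choose S hS hind hside using fun j => (I.isSide j).2.2
  let F : Set (Fin (n + 1) → E (n + 1)) := ⋃ j, S j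
  have hF : F.Finite := Set.finite_iUnion hS
  have hloc : ∀ v ∈ F, ∃ B : ℝ, (∀ x ∈ convexHull ℝ (Set.range v),
      ∀ y ∈ convexHull ℝ (Set.range v), dist x y ≤ B) ∧
      ∀ p : MvPolynomial (Fin (n + 1)) ℝ, p.totalDegree ≤ m →
      ∀ x ∈ convexHull ℝ (Set.range v), ∀ t : ℝ, 0 < t →
        ‖polyFun p x‖ₑ ≤ ENNReal.ofReal B * (ENNReal.ofReal (t ^ (-(n : ℝ) / 2)) *
          eLpNorm (polyFun p) 2 ((μHE[n] : Measure (E (n + 1))).restrict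
            (AffineMap.homothety x t '' convexHull ℝ (Set.range v)))) := by
    intro v hv
    obtain ⟨j, hj⟩ := Set.mem_iUnion.mp hv
    obtain ⟨C, hC⟩ := exists_enorm_polyFun_le_homothety m (hind j v hj)
    have hb : Bornology.IsBounded (convexHull ℝ (Set.range v)) :=
      ((Set.finite_range v).isCompact_convexHull (𝕜 := ℝ)).isBounded
    -- One number bounds both the constant and the diameter, so a single maximum over `F` suffices.
    refine ⟨max C (Metric.diam (convexHull ℝ (Set.range v))), fun x hx y hy =>
      (Metric.dist_le_diam_of_mem hb hx hy).trans (le_max_right _ _), fun p hp x hx t ht =>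
      (hC p hp x hx t ht).trans ?_⟩
    gcongr
    rw [← ENNReal.ofReal_coe_nnreal]
    exact ENNReal.ofReal_le_ofReal (le_max_left _ _)
  choose! B hBd hBe using hloc
  obtain ⟨A, hA⟩ := (hF.image B).bddAbove
  refine ⟨max A 1, max A 1, by positivity, by positivity, fun j x hx => ?_⟩
  rw [hside j] at hx
  obtain ⟨v, hv, hxv⟩ := Set.mem_iUnion₂.mp hx
  have hvF : v ∈ F := Set.mem_iUnion.mpr ⟨j, hv⟩
  have hle : B v ≤ max A 1 := (hA ⟨v, hvF, rfl⟩).trans (le_max_left _ _)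
  refine ⟨convexHull ℝ (Set.range v), hxv, ?_, convex_convexHull ℝ _, fun y hy =>
    (hBd v hvF x hxv y hy).trans hle, fun p hp t ht => ?_⟩
  · rw [hside j]
    exact Set.subset_biUnion_of_mem (u := fun v => convexHull ℝ (Set.range v)) hv
  · refine (hBe v hvF p hp x hxv t ht).trans ?_
    rw [← mul_assoc, ENNReal.ofReal_mul (by positivity)]
    gcongr

end UnfittedFEM

theorem mainTheorem4 (d : ℕ) (hd : d = 2 ∨ d = 3) (Ω : Set (E d)) (hΩ : IsPolyhedralDomain Ω)
    (I : PolyhedralInterface Ω) (Cν : ℝ) (m : ℕ) :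
    ∃ h₁ : ℝ, 0 < h₁ ∧ ∃ C : ℝ, 0 < C ∧
      ∀ M : Mesh Ω, M.IsQuasiUniform Cν → M.h < h₁ →
        ∀ T ∈ M.elems, ∀ K : Set (E d), (K = T.interior ∨ K = T.closedInterior) →
          (K ∩ I.Γ).Nonempty →
            ∀ p : MvPolynomial (Fin d) ℝ, p.totalDegree ≤ m →
              surfaceNorm (polyFun p) ⊤ (I.Γ ∩ K) ≤
                ENNReal.ofReal (C * diamK T ^ ((1 - (d : ℝ)) / 2)) *
                  surfaceNorm (polyFun p) 2 (I.Γτ T K) := by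
  obtain ⟨n, rfl⟩ : ∃ n, d = n + 1 := by
    rcases hd with rfl | rfl
    exacts [⟨1, rfl⟩, ⟨2, rfl⟩]
  obtain ⟨C, D, hC, hD, hloc⟩ := exists_uniform_local_estimate m I
  -- The simplices are shrunk by the factor `h_K / L`, which keeps them inside the ball.
  let L : ℝ := 2 * D * (n + 2)
  have hL : 0 < L := by positivity
  refine ⟨L, hL, C * (L⁻¹) ^ (-(n : ℝ) / 2), by positivity,
    fun M _ hM T hT K hK _ p hp => ?_⟩
  have hh : 0 < diamK T := diamK_pos T
  have hhL : diamK T < L := (diamK_le_h M hT).trans_lt hM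
  have hKT : K ⊆ T.closedInterior := by
    rcases hK with rfl | rfl
    exacts [T.interior_subset_closedInterior, subset_rfl]
  have ht : 0 < diamK T / L := by positivity
  have ht1 : diamK T / L ≤ 1 := (div_le_one hL).mpr hhL.le
  have hpt : ∀ x ∈ I.Γ ∩ K, ‖polyFun p x‖ₑ ≤
      ENNReal.ofReal (C * (L⁻¹) ^ (-(n : ℝ) / 2) * diamK T ^ ((1 - ((n + 1 : ℕ) : ℝ)) / 2)) *
        surfaceNorm (polyFun p) 2 (I.Γτ T K) := by
    rintro x ⟨hxΓ, hxK⟩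
    obtain ⟨j, hj⟩ := Set.mem_iUnion.mp hxΓ
    obtain ⟨σ, hxσ, hσj, hσ, hσD, hest⟩ := hloc j x hj
    refine (hest p hp _ ht).trans (mul_le_mul' (le_of_eq ?_) (eLpNorm_mono_measure _ ?_))
    · congr 1
      rw [div_eq_inv_mul, Real.mul_rpow (by positivity) hh.le, ← mul_assoc]
      congr 2
      push_cast
      ring
    · refine Measure.restrict_mono (fun y hy => ?_) le_rfl
      refine Set.mem_iUnion₂.mpr ⟨j, ⟨x, hj, hxK⟩,
        hσj (homothety_image_subset hσ hxσ ⟨ht.le, ht1⟩ hy), ?_⟩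
      obtain ⟨z, hz, rfl⟩ := hy
      have h1 : dist (AffineMap.homothety x (diamK T / L) z) x ≤ diamK T / (2 * (n + 2)) := by
        rw [dist_homothety_center, Real.norm_of_nonneg ht.le]
        calc diamK T / L * dist x z ≤ diamK T / L * D := by
              gcongr
              exact hσD z hz
          _ = diamK T / (2 * (n + 2)) := by
              simp only [L]
              field_simp
      have h2 := dist_centroid_le T (hKT hxK)
      -- The point `x` leaves room `h_K / (n + 2)` inside the ball; the factor 2 in `L` makes the
      -- shrunk simplex use only half of it, so the inclusion in the open ball is strict.
      have h3 : diamK T / (2 * (n + 2)) + ((n + 1 : ℕ) : ℝ) / ((n + 1 : ℕ) + 1) * diamK T =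
          diamK T - diamK T / (2 * (n + 2)) := by
        push_cast
        field_simp
        ring
      have h4 : 0 < diamK T / (2 * (n + 2)) := by positivity
      refine Metric.mem_ball.mpr ((dist_triangle _ x _).trans_lt ?_)
      linarith
  rw [surfaceNorm, eLpNorm_exponent_top]
  refine eLpNormEssSup_le_of_ae_enorm_bound ?_
  -- Measurability is needed only for the set where the bound holds, which is closed, and not for
  -- `I.Γ ∩ K`.
  rw [ae_restrict_iff]
  · exact ae_of_all _ hpt
  · exact (isClosed_le (continuous_polyFun p).enorm continuous_const).measurableSet
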